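/- A planar $st$-graph is a finite planar acyclic directed graph $G=(V,E)$ without parallel edges and with a single source $s$ and a single sink $t$ (the edge $(s,t)$ need not be present). Let $G$ be a planar $st$-graph with a fixed planar embedding in which $s$ and $t$ lie on the outer face. In such an embedding the outgoing edges of every vertex $u$ appear consecutively around $u$; let $S(u)=\{v_1,\dots,v_m\}$ be the list of successors of $u$, ordered as the outgoing edges $(u,v_1),\dots,(u,v_m)$ appear clockwise around $u$, where for $u=s$ the list is cut so that $v_m,s,v_1$ appear clockwise on the outer face. An $st$-ordering of $G$ is a bijection $\pi:V\to\{1,\dots,|V|\}$ with $\pi(s)=1$, $\pi(t)=|V|$ and $\pi(u)<\pi(v)$ for every edge $(u,v)\in E$. It is bitonic if for every vertex $u$ with $S(u)=\{v_1,\dots,v_m\}$, $m\ge 1$, there is $1\le h\le m$ with $\pi(v_1)<\cdots<\pi(v_h)>\cdots>\pi(v_m)$. Write $v\rightsquigarrow w$ if there is a directed path from $v$ to $w$ in $G$. Then $G$ admits a bitonic $st$-ordering if and only if there is no forbidden configuration, that is, if and only if for every vertex $u\in V$ with $S(u)=\{v_1,\dots,v_m\}$ and all $1\le i<j<m$, $$v_{i+1}\not\rightsquigarrow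 v_i\quad\text{or}\quad v_j\not\rightsquigarrow v_{j+1}.$$ In particular, if $G$ has no forbidden configuration, then $G$ admits a bitonic $st$-ordering. -/

import Mathlib

/-- A rotation system (combinatorial embedding) of a simple graph `H`: a permutation `next` of
the darts (oriented edges) which restricts, at every vertex `v`, to a single cyclic permutation of
the darts that leave `v`. The dart `next d` is the one that follows `d` in *clockwise* order around
the vertex `d.fst`. -/
structure RotationSystem {V : Type*} (H : SimpleGraph V) where
  next : Equiv.Perm H.Dart
  fst_next : ∀ d : H.Dart, (next d).fst = d.fst
  sameCycle_next : ∀ d e : H.Dart, d.fst = e.fst → next.SameCycle d e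

namespace RotationSystem

/-- The step of the face traversal: having walked along `d`, continue with the dart that follows
the reversal of `d` in clockwise order around the head of `d`. The traversed face is the one on
the left of each of its darts; hence an inner face is traversed counterclockwise, and the outer
face clockwise. -/
def faceNext {V : Type*} {H : SimpleGraph V} (R : RotationSystem H) : Equiv.Perm H.Dart :=
  (SimpleGraph.Dart.symm_involutive (G := H)).toPerm.trans R.next

/-- A face of a connected embedded graph, given by the set of the darts on whose left side it
lies: an orbit of the face traversal. A graph without edges has one face, with no dart. -/
def IsFace {V : Type*} {H : SimpleGraph V} (R : RotationSystem H) (f : Set H.Dart) : Prop :=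
  (∃ d : H.Dart, f = {e | R.faceNext.SameCycle d e}) ∨ (IsEmpty H.Dart ∧ f = ∅)

/-- A connected graph with a rotation system is embedded in the plane (equivalently, the sphere)
iff Euler's formula `|V| - |E| + |F| = 2` holds, that is, iff the genus is zero. -/
def IsPlanar {V : Type*} {H : SimpleGraph V} (R : RotationSystem H) : Prop :=
  Nat.card V + {f : Set H.Dart | R.IsFace f}.ncard = H.edgeSet.ncard + 2

end RotationSystem

/-- The vertex `v` is on the boundary of the face `f` of a connected embedded graph. (The last
alternative is the graph with a single vertex, which is on the boundary of the only face.) -/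
def OnFace {V : Type*} {H : SimpleGraph V} (f : Set H.Dart) (v : V) : Prop :=
  (∃ d ∈ f, d.fst = v) ∨ IsEmpty H.Dart

/-- An embedded planar `st`-graph: an acyclic directed graph (without parallel edges) with a single
source `s` and a single sink `t`, together with a fixed planar embedding in which `s` and `t` are
on the outer face. The edge `(s, t)` need not be present. If `V` is finite, then the underlying
undirected graph `graph.toSimpleGraphInclusive` is connected, because every vertex is reachable
from the only source; so Euler's formula describes planarity of the embedding. -/
structure EmbeddedPlanarSTGraph (V : Type*) where
  graph : Digraph V
  s : V
  t : V
  acyclic : ∀ v, ¬ Relation.TransGen graph.Adj v v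
  source_iff : ∀ v, (∀ u, ¬ graph.Adj u v) ↔ v = s
  sink_iff : ∀ v, (∀ w, ¬ graph.Adj v w) ↔ v = t
  rot : RotationSystem graph.toSimpleGraphInclusive
  planar : rot.IsPlanar
  outer : Set graph.toSimpleGraphInclusive.Dart
  outer_isFace : rot.IsFace outer
  s_outer : OnFace outer s
  t_outer : OnFace outer t

namespace EmbeddedPlanarSTGraph

/-- There is a directed path from `u` to `v`. -/
def HasPath {V : Type*} (G : EmbeddedPlanarSTGraph V) (u v : V) : Prop :=
  Relation.ReflTransGen G.graph.Adj u v

/-- A dart at `u` from which the clockwise enumeration of the outgoing edges of `u` may start: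
at `s` it is the dart that follows the outer face in clockwise order around `s`, that is, the dart
`(s, v₁)` where `v_m, s, v₁` appear clockwise on the outer face; at every other vertex it is any
incoming edge (traversed backwards), the outgoing edges being consecutive around `u`. -/
def IsStartDart {V : Type*} (G : EmbeddedPlanarSTGraph V) (u : V)
    (d : G.graph.toSimpleGraphInclusive.Dart) : Prop :=
  d.fst = u ∧ ((u = G.s ∧ d ∈ G.outer) ∨ (u ≠ G.s ∧ G.graph.Adj d.snd d.fst))

/-- All darts at the vertex `d.fst` in clockwise order, starting with `d`. -/
noncomputable def rotationList {V : Type*} (G : EmbeddedPlanarSTGraph V)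
    (d : G.graph.toSimpleGraphInclusive.Dart) : List G.graph.toSimpleGraphInclusive.Dart :=
  List.iterate G.rot.next d (Function.minimalPeriod G.rot.next d)

open Classical in
/-- The successor list `S(u) = [v₁, …, v_m]`: the heads of the outgoing edges of `u` in clockwise
order around `u`. It is empty if `u` has no outgoing edge. -/
noncomputable def succList {V : Type*} (G : EmbeddedPlanarSTGraph V) (u : V) : List V :=
  if h : ∃ d, G.IsStartDart u d then
    ((G.rotationList h.choose).filter (fun d => G.graph.Adj d.fst d.snd)).map (fun d => d.snd)
  else []

/-- `π` is (the rank function of) an `st`-ordering `s = v₁, …, v_n = t` of `G`. -/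
def IsSTOrdering {V : Type*} (G : EmbeddedPlanarSTGraph V) (π : V → ℕ) : Prop :=
  Set.BijOn π Set.univ (Set.Icc 1 (Nat.card V)) ∧ π G.s = 1 ∧ π G.t = Nat.card V ∧
    ∀ u v, G.graph.Adj u v → π u < π v

end EmbeddedPlanarSTGraph

/-- The list `l = [v₁, …, v_m]` is (strictly) bitonic with respect to `π`: there is `h` with
`π v₁ < ⋯ < π v_h > ⋯ > π v_m` (indices are shifted by one here). The empty list counts as
bitonic. -/
def IsBitonicList {V : Type*} (π : V → ℕ) (l : List V) : Prop :=
  l = [] ∨ ∃ h, h < l.length ∧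
    (∀ i, ∀ hi : i + 1 < l.length, i < h → π l[i] < π l[i + 1]) ∧
    (∀ i, ∀ hi : i + 1 < l.length, h ≤ i → π l[i + 1] < π l[i])

namespace EmbeddedPlanarSTGraph

/-- `π` is a bitonic `st`-ordering of `G`. -/
def IsBitonicSTOrdering {V : Type*} (G : EmbeddedPlanarSTGraph V) (π : V → ℕ) : Prop :=
  G.IsSTOrdering π ∧ ∀ u, IsBitonicList π (G.succList u)

/-- The successor list `[v₁, …, v_m]` of `u` has a forbidden configuration: paths
`v_{i+1} ⇝ v_i` and `v_j ⇝ v_{j+1}` for some `1 ≤ i < j < m` (indices are shifted by one here). -/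
def HasForbiddenConfiguration {V : Type*} (G : EmbeddedPlanarSTGraph V) (u : V) : Prop :=
  ∃ i j, ∃ hij : i < j, ∃ hj : j + 1 < (G.succList u).length,
    G.HasPath (G.succList u)[i + 1] (G.succList u)[i] ∧
    G.HasPath (G.succList u)[j] (G.succList u)[j + 1]

end EmbeddedPlanarSTGraph

/-! Necessity: `π` increases along paths, so a forbidden configuration makes the successor list
descend at `i` and ascend at a later `j`.

Sufficiency: without forbidden configurations every nonempty successor list has a position `h`, the
peak, such that no path opposes directing all consecutive pairs towards it (`exists_peak`). Add
these edges between consecutive successors. If the augmented graph is acyclic, each of its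
topological numberings is a bitonic `st`-ordering.

Two facts about the embedding come from counting corners with Euler's formula
(`bijective_face_and_fst`): each face has exactly one source corner, and the outgoing edges at a
vertex are consecutive. Hence each added edge lies in its own inner face.

Acyclicity (`IsAdmissible.not_transGen_augAdj`) is proved by homology. A closed walk yields a chain
`C ≥ 0` on the edges of `G` and signed multiplicities `σ` of the added edges. Rerouting each added
edge through the common predecessor turns the walk into a cycle on `G`; as the genus is zero, this
cycle is `faceDiff φ`, with `φ` a winding number. An added edge at the corner `k` cuts its face `f`
into a lower part next to the corner, of potential `φ f - σ k`, and an upper part of potential `φ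
f`. Since `C ≥ 0`, the potential does not increase from the left to the right of an edge of `G`. The
dual graph on the inner faces is acyclic (`not_transGen_faceAdj`), so induction to the right and to
the left bounds all potentials below and above by that of the outer face. They are all equal;
therefore `C` and `σ` vanish, which is absurd. -/

namespace Equiv.Perm

/-- A predicate that holds somewhere on a cycle of a permutation, but not everywhere, fails
somewhere right after it holds. -/
theorem SameCycle.exists_and_not_apply {α : Type*} [Finite α] {σ : Equiv.Perm α} {x y : α}
    (h : σ.SameCycle x y) {p : α → Prop} (hx : p x) (hy : ¬ p y) :
    ∃ z, σ.SameCycle x z ∧ p z ∧ ¬ p (σ z) := by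
  by_contra! H
  obtain ⟨n, rfl⟩ := h.exists_nat_pow_eq
  have key : ∀ k : ℕ, p ((σ ^ k) x) := by
    intro k
    induction k with
    | zero => simpa using hx
    | succ k ih =>
      rw [pow_succ', Equiv.Perm.mul_apply]
      exact H _ ⟨k, by simp⟩ ih
  exact hy (key n)

end Equiv.Perm

/-! ### Darts, faces, and the corner count from Euler's formula -/

namespace EmbeddedPlanarSTGraph

variable {V : Type*} (G : EmbeddedPlanarSTGraph V)

/-- The darts of the underlying undirected graph. -/
abbrev Dart : Type _ := G.graph.toSimpleGraphInclusive.Dart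

variable {G} in
/-- The dart is oriented along its edge of the digraph. -/
def Out (d : G.Dart) : Prop := G.graph.Adj d.fst d.snd

/-- The edges of the digraph, as darts. -/
abbrev Edge : Type _ := {d : G.Dart // Out d}

/-- The faces of the embedding. -/
def Face : Type _ := Quotient (Equiv.Perm.SameCycle.setoid G.rot.faceNext)

variable {G} in
/-- The face on the left of a dart. -/
def face (d : G.Dart) : G.Face := Quotient.mk _ d

/-- The dart of a directed edge. -/
def dart {u v : V} (h : G.graph.Adj u v) : G.Dart :=
  ⟨(u, v), by
    refine ⟨fun e => ?_, Or.inl h⟩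
    have e : u = v := e
    exact G.acyclic v (.single (e ▸ h))⟩

instance [Finite V] : Finite G.Dart :=
  Finite.of_injective _ SimpleGraph.Dart.toProd_injective

noncomputable instance [Finite V] : Fintype G.Dart := Fintype.ofFinite _

instance [Finite V] : Finite G.Edge := Subtype.finite

noncomputable instance [Finite V] : Fintype G.Edge := Fintype.ofFinite _

instance [Finite V] : Finite G.Face := Quotient.finite _

noncomputable instance [Finite V] : Fintype G.Face := Fintype.ofFinite _

variable {G}

theorem out_dart {u v : V} (h : G.graph.Adj u v) : Out (G.dart h) := h

theorem face_eq_iff {d e : G.Dart} : face d = face e ↔ G.rot.faceNext.SameCycle d e :=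
  Quotient.eq (r := Equiv.Perm.SameCycle.setoid G.rot.faceNext)

theorem faceNext_apply (d : G.Dart) : G.rot.faceNext d = G.rot.next d.symm := rfl

@[simp]
theorem face_faceNext (d : G.Dart) : face (G.rot.faceNext d) = face d :=
  face_eq_iff.2 (Equiv.Perm.sameCycle_apply_left.2 (Equiv.Perm.SameCycle.refl _ _))

theorem face_next (d : G.Dart) : face (G.rot.next d) = face d.symm := by
  rw [← face_faceNext d.symm, faceNext_apply, SimpleGraph.Dart.symm_symm]

theorem fst_faceNext (d : G.Dart) : (G.rot.faceNext d).fst = d.snd :=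
  G.rot.fst_next d.symm

theorem Out.not_symm {d : G.Dart} (h : Out d) : ¬ Out d.symm := fun h' =>
  G.acyclic _ (.head h (.single h'))

theorem out_symm_iff {d : G.Dart} : Out d.symm ↔ ¬ Out d := by
  refine ⟨fun h h' => h'.not_symm h, fun h => ?_⟩
  exact d.adj.2.resolve_left h

theorem HasPath.antisymm {u v : V} (h : G.HasPath u v) (h' : G.HasPath v u) : u = v := by
  rcases h.cases_head with h | ⟨w, hw, hwv⟩
  · exact h
  · exact (G.acyclic u (.head' hw (hwv.trans h'))).elim

theorem wellFounded_adj [Finite V] : WellFounded G.graph.Adj := by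
  have : IsTrans V (Relation.TransGen G.graph.Adj) := ⟨fun _ _ _ => .trans⟩
  have : Std.Irrefl (Relation.TransGen G.graph.Adj) := ⟨G.acyclic⟩
  exact (Finite.wellFounded_of_trans_of_irrefl (Relation.TransGen G.graph.Adj)).mono
    fun _ _ => .single

theorem wellFounded_adj_swap [Finite V] : WellFounded (Function.swap G.graph.Adj) := by
  have : IsTrans V (Function.swap (Relation.TransGen G.graph.Adj)) :=
    ⟨fun _ _ _ h h' => Relation.TransGen.trans h' h⟩
  have : Std.Irrefl (Function.swap (Relation.TransGen G.graph.Adj)) := ⟨G.acyclic⟩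
  exact (Finite.wellFounded_of_trans_of_irrefl
    (Function.swap (Relation.TransGen G.graph.Adj))).mono
    fun _ _ h => Relation.TransGen.single (r := G.graph.Adj) h

theorem hasPath_source [Finite V] (v : V) : G.HasPath G.s v := by
  induction v using (wellFounded_adj (G := G)).induction with
  | _ v ih =>
    by_cases hv : v = G.s
    · subst hv; exact .refl
    · rw [← G.source_iff] at hv
      push Not at hv
      obtain ⟨u, hu⟩ := hv
      exact (ih u hu).tail hu

theorem hasPath_sink [Finite V] (v : V) : G.HasPath v G.t := by
  induction v using (wellFounded_adj_swap (G := G)).induction with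
  | _ v ih =>
    by_cases hv : v = G.t
    · subst hv; exact .refl
    · rw [← G.sink_iff] at hv
      push Not at hv
      obtain ⟨u, hu⟩ := hv
      exact (ih u hu).head hu

theorem out_of_fst_eq_source {d : G.Dart} (h : d.fst = G.s) : Out d := by
  by_contra hd
  exact (G.source_iff d.fst).2 h _ (out_symm_iff.2 hd)

theorem exists_out [h : Nonempty G.Dart] : ∃ d : G.Dart, Out d := by
  obtain ⟨d⟩ := h
  by_cases hd : Out d
  · exact ⟨d, hd⟩
  · exact ⟨d.symm, out_symm_iff.2 hd⟩

theorem source_ne_sink [Finite V] [Nonempty G.Dart] : G.s ≠ G.t := by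
  intro h
  obtain ⟨d, hd⟩ := exists_out (G := G)
  have h1 : G.HasPath G.s d.fst := hasPath_source _
  have h2 : G.HasPath d.snd G.t := hasPath_sink _
  rw [← h] at h2
  exact G.acyclic d.fst (.head' hd (h2.trans h1))

theorem card_edge : Nat.card G.Edge = G.graph.toSimpleGraphInclusive.edgeSet.ncard := by
  rw [← Nat.card_coe_set_eq]
  refine Nat.card_eq_of_bijective (fun e : G.Edge => ⟨e.1.edge, e.1.edge_mem⟩) ⟨?_, ?_⟩
  · rintro ⟨d, hd⟩ ⟨e, he⟩ h
    simp only [Subtype.mk.injEq, SimpleGraph.dart_edge_eq_iff] at h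
    rcases h with rfl | rfl
    · rfl
    · exact (he.not_symm hd).elim
  · rintro ⟨e, he⟩
    induction e with
    | _ u v =>
      rcases he.2 with h | h
      · exact ⟨⟨G.dart h, h⟩, rfl⟩
      · exact ⟨⟨G.dart h, h⟩, Subtype.ext Sym2.eq_swap⟩

theorem card_face [Nonempty G.Dart] : Nat.card G.Face = {f | G.rot.IsFace f}.ncard := by
  have h : {f | G.rot.IsFace f} = Set.range fun q : G.Face => {e : G.Dart | face e = q} := by
    ext f
    simp only [Set.mem_ofPred_eq, RotationSystem.IsFace, not_isEmpty_of_nonempty, false_and,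
      or_false, Set.mem_range]
    constructor
    · rintro ⟨d, rfl⟩
      exact ⟨face d, Set.ext fun e => eq_comm.trans face_eq_iff⟩
    · rintro ⟨q, rfl⟩
      induction q using Quotient.inductionOn with
      | _ d => exact ⟨d, Set.ext fun e => eq_comm.trans face_eq_iff⟩
  rw [h, ← Nat.card_coe_set_eq, Nat.card_range_of_injective]
  intro q r hqr
  induction q using Quotient.inductionOn with
  | _ d =>
    have : d ∈ {e : G.Dart | face e = r} := by
      rw [← show _ = {e : G.Dart | face e = r} from hqr]
      rfl
    exact this

theorem euler [Nonempty G.Dart] : Nat.card V + Nat.card G.Face = Nat.card G.Edge + 2 := by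
  rw [card_edge, card_face]
  exact G.planar

/-- A part of a face traversal that follows the directions of the edges is a directed path. -/
theorem hasPath_of_forall_out {d : G.Dart} {n : ℕ}
    (h : ∀ k < n, Out ((G.rot.faceNext ^ k) d)) :
    G.HasPath d.fst ((G.rot.faceNext ^ n) d).fst := by
  induction n with
  | zero => exact .refl
  | succ n ih =>
    refine (ih fun k hk => h k (by omega)).tail ?_
    rw [pow_succ', Equiv.Perm.mul_apply, fst_faceNext]
    exact h n (by omega)

theorem hasPath_of_forall_not_out {d : G.Dart} {n : ℕ}
    (h : ∀ k < n, ¬ Out ((G.rot.faceNext ^ k) d)) :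
    G.HasPath ((G.rot.faceNext ^ n) d).fst d.fst := by
  induction n with
  | zero => exact .refl
  | succ n ih =>
    refine Relation.ReflTransGen.head ?_ (ih fun k hk => h k (by omega))
    rw [pow_succ', Equiv.Perm.mul_apply, fst_faceNext]
    exact out_symm_iff.2 (h n (by omega))

/-- Otherwise the closed traversal of the face would be a directed cycle. -/
theorem exists_not_out_of_face [Finite V] (f : G.Face) : ∃ d, face d = f ∧ ¬ Out d := by
  induction f using Quotient.inductionOn with
  | _ d =>
    by_contra! H
    have key : ∀ k : ℕ, Out ((G.rot.faceNext ^ k) d) := fun k =>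
      H _ (face_eq_iff.2 (Equiv.Perm.SameCycle.symm ⟨k, by simp⟩))
    obtain ⟨n, hn, h⟩ := (isOfFinOrder_of_finite G.rot.faceNext).exists_pow_eq_one
    have h1 := hasPath_of_forall_out (n := n - 1) (d := G.rot.faceNext d) fun k _ => by
      simpa [← Equiv.Perm.mul_apply, ← pow_succ] using key (k + 1)
    rw [← Equiv.Perm.mul_apply, ← pow_succ, Nat.sub_add_cancel hn, h, fst_faceNext] at h1
    exact G.acyclic _ (.head' (key 0) h1)

theorem exists_out_of_face [Finite V] (f : G.Face) : ∃ d, face d = f ∧ Out d := by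
  induction f using Quotient.inductionOn with
  | _ d =>
    by_contra! H
    have key : ∀ k : ℕ, ¬ Out ((G.rot.faceNext ^ k) d) := fun k =>
      H _ (face_eq_iff.2 (Equiv.Perm.SameCycle.symm ⟨k, by simp⟩))
    obtain ⟨n, hn, h⟩ := (isOfFinOrder_of_finite G.rot.faceNext).exists_pow_eq_one
    have h1 := hasPath_of_forall_not_out (n := n - 1) (d := G.rot.faceNext d) fun k _ => by
      simpa [← Equiv.Perm.mul_apply, ← pow_succ] using key (k + 1)
    rw [← Equiv.Perm.mul_apply, ← pow_succ, Nat.sub_add_cancel hn, h, fst_faceNext] at h1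
    exact G.acyclic _ (.tail' h1 (out_symm_iff.2 (key 0)))

/-- The dart `d` and its clockwise successor are both outgoing: they enclose a corner at which
the face between them has a source. -/
def IsSourceCorner (d : G.Dart) : Prop := Out d ∧ Out (G.rot.next d)

/-- The traversal of a face uses edges both backwards and forwards, so somewhere it switches from
backwards to forwards; the switch is a source corner. -/
theorem exists_isSourceCorner [Finite V] (f : G.Face) :
    ∃ d, IsSourceCorner d ∧ face (G.rot.next d) = f := by
  obtain ⟨d, hd, hdo⟩ := exists_not_out_of_face f
  obtain ⟨e, he, heo⟩ := exists_out_of_face f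
  obtain ⟨x, hdx, hx, hx'⟩ :=
    (face_eq_iff.1 (hd.trans he.symm)).exists_and_not_apply (p := fun d => ¬ Out d) hdo
      (not_not.2 heo)
  refine ⟨x.symm, ⟨out_symm_iff.2 hx, not_not.1 hx'⟩, ?_⟩
  rw [← faceNext_apply, face_faceNext, ← hd]
  exact face_eq_iff.2 hdx.symm

theorem exists_last_out [Finite V] {u : V} (hs : u ≠ G.s) (ht : u ≠ G.t) :
    ∃ d : G.Dart, d.fst = u ∧ Out d ∧ ¬ Out (G.rot.next d) := by
  rw [Ne, ← G.source_iff] at hs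
  rw [Ne, ← G.sink_iff] at ht
  push Not at hs ht
  obtain ⟨v, hv⟩ := hs
  obtain ⟨w, hw⟩ := ht
  obtain ⟨x, hx, h⟩ := (G.rot.sameCycle_next (G.dart hw) (G.dart hv).symm rfl).exists_and_not_apply
    (p := Out) hw (out_dart hv).not_symm
  refine ⟨x, ?_, h⟩
  obtain ⟨n, rfl⟩ := hx.exists_nat_pow_eq
  clear hx h
  induction n with
  | zero => rfl
  | succ n ih => rwa [pow_succ', Equiv.Perm.mul_apply, G.rot.fst_next]

/-- By Euler's formula, every face has exactly one source corner, and at every vertex at most one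
outgoing edge is followed by an incoming one. -/
theorem bijective_face_and_fst [Finite V] [Nonempty G.Dart] :
    (Function.Bijective fun d : {d : G.Dart // IsSourceCorner d} => face (G.rot.next d.1)) ∧
    Function.Injective fun d : {d : G.Dart // Out d ∧ ¬ Out (G.rot.next d)} => d.1.fst := by
  set C := {d : G.Dart // IsSourceCorner d}
  set T := {d : G.Dart // Out d ∧ ¬ Out (G.rot.next d)}
  have hfs : ∀ d : T, d.1.fst ≠ G.s ∧ d.1.fst ≠ G.t := fun d =>
    ⟨fun h => d.2.2 (out_of_fst_eq_source (by rw [G.rot.fst_next, h])),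
      fun h => (G.sink_iff d.1.fst).2 h _ d.2.1⟩
  let g : T → {u : V // u ≠ G.s ∧ u ≠ G.t} := fun d => ⟨d.1.fst, hfs d⟩
  have hf : Function.Surjective fun d : C => face (G.rot.next d.1) := fun f => by
    obtain ⟨d, hd, h⟩ := exists_isSourceCorner f
    exact ⟨⟨d, hd⟩, h⟩
  have hg : Function.Surjective g := fun u => by
    obtain ⟨d, hd, h⟩ := exists_last_out u.2.1 u.2.2
    exact ⟨⟨d, h⟩, Subtype.ext hd⟩
  -- Edges are classified by whether their clockwise successor is outgoing. As `C` surjects onto the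
  -- faces and `T` onto the vertices other than `s` and `t`, Euler's formula `|E| = |F| + (|V| - 2)`
  -- forces both surjections to be bijections.
  have hE : Nat.card G.Edge = Nat.card C + Nat.card T := by
    classical
    rw [← Nat.card_sum]
    refine Nat.card_congr ((Equiv.sumCompl fun e : G.Edge => Out (G.rot.next e.1)).symm.trans
      (Equiv.sumCongr ?_ ?_))
    · exact Equiv.subtypeSubtypeEquivSubtypeInter _ fun d => Out (G.rot.next d)
    · exact Equiv.subtypeSubtypeEquivSubtypeInter _ fun d => ¬ Out (G.rot.next d)
  have hV : Nat.card V = Nat.card {u : V // u ≠ G.s ∧ u ≠ G.t} + 2 := by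
    have h1 : {u : V | u ≠ G.s ∧ u ≠ G.t} = ({G.s, G.t} : Set V)ᶜ := by ext; simp
    have h2 := Set.ncard_add_ncard_compl ({G.s, G.t} : Set V)
    rw [Set.ncard_pair source_ne_sink, ← h1] at h2
    rw [← h2, add_comm]
    rfl
  have h1 := Nat.card_le_card_of_surjective _ hf
  have h2 := Nat.card_le_card_of_surjective _ hg
  have h3 := euler (G := G)
  have hf' := hf.bijective_of_nat_card_le (by omega)
  have hg' := hg.bijective_of_nat_card_le (by omega)
  exact ⟨hf', fun d e h => hg'.1 (Subtype.ext h)⟩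

theorem IsSourceCorner.eq_of_face_eq [Finite V] {d e : G.Dart} (hd : IsSourceCorner d)
    (he : IsSourceCorner e) (h : face (G.rot.next d) = face (G.rot.next e)) : d = e := by
  have : Nonempty G.Dart := ⟨d⟩
  exact congrArg Subtype.val (bijective_face_and_fst.1.1 (a₁ := ⟨d, hd⟩) (a₂ := ⟨e, he⟩) h)

theorem last_out_unique [Finite V] {d e : G.Dart} (hd : Out d) (hd' : ¬ Out (G.rot.next d))
    (he : Out e) (he' : ¬ Out (G.rot.next e)) (h : d.fst = e.fst) : d = e := by
  have : Nonempty G.Dart := ⟨d⟩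
  exact congrArg Subtype.val
    (bijective_face_and_fst.2 (a₁ := ⟨d, hd, hd'⟩) (a₂ := ⟨e, he, he'⟩) h)

end EmbeddedPlanarSTGraph

/-! ### Cycles and cocycles of the plane graph -/

namespace EmbeddedPlanarSTGraph

variable {V : Type*} (G : EmbeddedPlanarSTGraph V)

/-- The coboundary of a function on the vertices. -/
def vertexDiff : (V → ℚ) →ₗ[ℚ] (G.Edge → ℚ) where
  toFun ψ e := ψ e.1.snd - ψ e.1.fst
  map_add' ψ ψ' := by ext e; simp only [Pi.add_apply]; ring
  map_smul' a ψ := by ext e; simp only [Pi.smul_apply, smul_eq_mul, RingHom.id_apply]; ring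

/-- The boundary of a function on the faces. -/
def faceDiff : (G.Face → ℚ) →ₗ[ℚ] (G.Edge → ℚ) where
  toFun φ e := φ (face e.1) - φ (face e.1.symm)
  map_add' ψ ψ' := by ext e; simp only [Pi.add_apply]; ring
  map_smul' a ψ := by ext e; simp only [Pi.smul_apply, smul_eq_mul, RingHom.id_apply]; ring

variable {G}

theorem vertexDiff_apply (ψ : V → ℚ) (e : G.Edge) :
    G.vertexDiff ψ e = ψ e.1.snd - ψ e.1.fst := rfl

theorem faceDiff_apply (φ : G.Face → ℚ) (e : G.Edge) :
    G.faceDiff φ e = φ (face e.1) - φ (face e.1.symm) := rfl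

theorem sum_dart [Finite V] (f : G.Dart → ℚ) :
    ∑ d, f d = ∑ e : G.Edge, (f e.1 + f e.1.symm) := by
  classical
  rw [Finset.sum_add_distrib]
  refine ((Fintype.sum_sum_type
    (Sum.elim (fun e : G.Edge => f e.1) fun e : G.Edge => f e.1.symm)).symm.trans ?_).symm
  refine Fintype.sum_bijective
    (Sum.elim (fun e : G.Edge => e.1) fun e : G.Edge => e.1.symm) ⟨?_, fun d => ?_⟩ _ _ ?_
  · refine Function.Injective.sumElim Subtype.val_injective
      (SimpleGraph.Dart.symm_involutive.injective.comp Subtype.val_injective) ?_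
    rintro ⟨d, hd⟩ ⟨e, he⟩ rfl
    exact he.not_symm hd
  · by_cases hd : Out d
    · exact ⟨Sum.inl ⟨d, hd⟩, rfl⟩
    · exact ⟨Sum.inr ⟨d.symm, out_symm_iff.2 hd⟩, d.symm_symm⟩
  · rintro (e | e) <;> rfl

/-- Face boundaries are closed walks, along which the differences of `ψ` telescope: summed over all
darts, heads and tails are exchanged by `faceNext`, which preserves the face. -/
theorem vertexDiff_dotProduct_faceDiff [Finite V] (ψ : V → ℚ) (φ : G.Face → ℚ) :
    G.vertexDiff ψ ⬝ᵥ G.faceDiff φ = 0 := by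
  have h1 : G.vertexDiff ψ ⬝ᵥ G.faceDiff φ =
      ∑ d : G.Dart, (ψ d.snd - ψ d.fst) * φ (face d) := by
    rw [sum_dart]
    refine Finset.sum_congr rfl fun e _ => ?_
    have h2 : e.1.symm.snd = e.1.fst := rfl
    have h3 : e.1.symm.fst = e.1.snd := rfl
    rw [vertexDiff_apply, faceDiff_apply, h2, h3]
    ring
  have h2 : ∑ d : G.Dart, ψ d.snd * φ (face d) = ∑ d : G.Dart, ψ d.fst * φ (face d) := by
    rw [← Equiv.sum_comp G.rot.faceNext fun d => ψ d.fst * φ (face d)]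
    simp only [fst_faceNext, face_faceNext]
  rw [h1]
  simp only [sub_mul, Finset.sum_sub_distrib, h2, sub_self]

theorem eq_source_of_vertexDiff_eq_zero [Finite V] {ψ : V → ℚ} (h : G.vertexDiff ψ = 0) (v : V) :
    ψ v = ψ G.s := by
  induction hasPath_source (G := G) v with
  | refl => rfl
  | tail _ hvw ih =>
    have := congrFun h ⟨G.dart hvw, hvw⟩
    rw [vertexDiff_apply, Pi.zero_apply, sub_eq_zero] at this
    exact this.trans ih

/-- The dual graph is connected: `φ` does not change across an edge, hence not around a vertex,
hence not along paths from the source. -/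
theorem eq_of_faceDiff_eq_zero [Finite V] {φ : G.Face → ℚ} (h : G.faceDiff φ = 0)
    (f g : G.Face) : φ f = φ g := by
  have hsymm : ∀ d : G.Dart, φ (face d.symm) = φ (face d) := by
    intro d
    by_cases hd : Out d
    · exact (sub_eq_zero.1 (congrFun h ⟨d, hd⟩)).symm
    · have := sub_eq_zero.1 (congrFun h ⟨d.symm, out_symm_iff.2 hd⟩)
      simpa using this
  have hvertex : ∀ d e : G.Dart, d.fst = e.fst → φ (face d) = φ (face e) := by
    intro d e hde
    obtain ⟨n, rfl⟩ := (G.rot.sameCycle_next d e hde).exists_nat_pow_eq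
    clear hde
    induction n with
    | zero => rfl
    | succ n ih => rwa [pow_succ', Equiv.Perm.mul_apply, face_next, hsymm]
  -- Including the darts at `s` makes the value `a` the same for all `v`.
  have key : ∀ v, ∃ a, ∀ d : G.Dart, (d.fst = v ∨ d.fst = G.s) → φ (face d) = a := by
    intro v
    induction hasPath_source (G := G) v with
    | refl =>
      by_cases hs : ∃ d : G.Dart, d.fst = G.s
      · obtain ⟨d, hd⟩ := hs
        exact ⟨φ (face d), fun e he => hvertex e d ((or_self_iff.1 he).trans hd.symm)⟩
      · exact ⟨0, fun e he => (hs ⟨e, or_self_iff.1 he⟩).elim⟩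
    | @tail v w _ hvw ih =>
      obtain ⟨a, ha⟩ := ih
      refine ⟨a, fun d hd => ?_⟩
      rcases hd with hd | hd
      · rw [hvertex d (G.dart hvw).symm hd, hsymm]
        exact ha _ (Or.inl rfl)
      · exact ha d (Or.inr hd)
  obtain ⟨d0, hd0⟩ | hd0 := em (∃ d : G.Dart, d.fst = G.s)
  · have key' : ∀ f : G.Face, φ f = φ (face d0) := by
      intro f
      induction f using Quotient.inductionOn with
      | _ d =>
        obtain ⟨a, ha⟩ := key d.fst
        exact (ha d (Or.inl rfl)).trans (ha d0 (Or.inr hd0)).symm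
    rw [key' f, key' g]
  · exfalso
    induction f using Quotient.inductionOn with
    | _ d =>
      rcases (hasPath_source (G := G) d.fst).cases_head with h | ⟨w, hw, _⟩
      · exact hd0 ⟨d, h.symm⟩
      · exact hd0 ⟨G.dart hw, rfl⟩

/-- Hodge decomposition: the genus of a plane graph being zero, there is no harmonic part. -/
theorem exists_vertexDiff_add_faceDiff [Finite V] [Nonempty G.Dart] (c : G.Edge → ℚ) :
    ∃ ψ φ, c = G.vertexDiff ψ + G.faceDiff φ := by
  have : Fintype V := Fintype.ofFinite V
  obtain ⟨d0⟩ := ‹Nonempty G.Dart›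
  -- Both kernels consist of constants, so the two ranges, which are orthogonal, have dimensions at
  -- least `|V| - 1` and `|F| - 1`. By Euler's formula these add up to `|E|`.
  have h1 : Module.finrank ℚ (LinearMap.ker G.vertexDiff) ≤ 1 := by
    refine finrank_le_one ⟨fun _ => 1, by
      ext e; simp [vertexDiff_apply]⟩ fun ψ => ⟨ψ.1 G.s, Subtype.ext (funext fun v => ?_)⟩
    simpa using (eq_source_of_vertexDiff_eq_zero ψ.2 v).symm
  have h2 : Module.finrank ℚ (LinearMap.ker G.faceDiff) ≤ 1 := by
    refine finrank_le_one ⟨fun _ => 1, by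
      ext e; simp [faceDiff_apply]⟩ fun φ => ⟨φ.1 (face d0), Subtype.ext (funext fun v => ?_)⟩
    simpa using (eq_of_faceDiff_eq_zero φ.2 v (face d0)).symm
  have h3 := LinearMap.finrank_range_add_finrank_ker G.vertexDiff
  have h4 := LinearMap.finrank_range_add_finrank_ker G.faceDiff
  have h5 : LinearMap.range G.vertexDiff ⊓ LinearMap.range G.faceDiff = ⊥ := by
    rw [eq_bot_iff]
    rintro x ⟨⟨ψ, rfl⟩, ⟨φ, hφ⟩⟩
    have := vertexDiff_dotProduct_faceDiff ψ φ
    rw [hφ] at this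
    exact dotProduct_self_eq_zero.1 this
  have h6 := Submodule.finrank_sup_add_finrank_inf_eq (LinearMap.range G.vertexDiff)
    (LinearMap.range G.faceDiff)
  rw [h5, finrank_bot] at h6
  have h7 : Module.finrank ℚ ↥(LinearMap.range G.vertexDiff ⊔ LinearMap.range G.faceDiff) ≤ _ :=
    Submodule.finrank_le _
  rw [Module.finrank_fintype_fun_eq_card, ← Nat.card_eq_fintype_card] at h3 h4 h7
  have h8 := euler (G := G)
  have h9 : LinearMap.range G.vertexDiff ⊔ LinearMap.range G.faceDiff = ⊤ := by
    apply Submodule.eq_top_of_finrank_eq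
    rw [Module.finrank_fintype_fun_eq_card, ← Nat.card_eq_fintype_card]
    omega
  obtain ⟨_, ⟨ψ, rfl⟩, _, ⟨φ, rfl⟩, h⟩ :=
    Submodule.mem_sup.1 (h9 ▸ Submodule.mem_top : c ∈ _)
  exact ⟨ψ, φ, h.symm⟩

/-- The `faceDiff` component of the decomposition is orthogonal to itself, hence zero over `ℚ`. -/
theorem exists_eq_vertexDiff [Finite V] [Nonempty G.Dart] {c : G.Edge → ℚ}
    (hc : ∀ φ, c ⬝ᵥ G.faceDiff φ = 0) : ∃ ψ, c = G.vertexDiff ψ := by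
  obtain ⟨ψ, φ, rfl⟩ := exists_vertexDiff_add_faceDiff c
  have := hc φ
  rw [add_dotProduct, vertexDiff_dotProduct_faceDiff, zero_add, dotProduct_self_eq_zero] at this
  exact ⟨ψ, by rw [this, add_zero]⟩

theorem exists_eq_faceDiff [Finite V] [Nonempty G.Dart] {c : G.Edge → ℚ}
    (hc : ∀ ψ, c ⬝ᵥ G.vertexDiff ψ = 0) : ∃ φ, c = G.faceDiff φ := by
  obtain ⟨ψ, φ, rfl⟩ := exists_vertexDiff_add_faceDiff c
  have := hc ψ
  rw [add_dotProduct, dotProduct_comm (G.faceDiff φ), vertexDiff_dotProduct_faceDiff, add_zero,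
    dotProduct_self_eq_zero] at this
  exact ⟨φ, by rw [this, zero_add]⟩

/-! ### The outer face and acyclicity of the dual graph on the inner faces -/

theorem exists_outer_eq [Nonempty G.Dart] : ∃ o : G.Face, ∀ d, d ∈ G.outer ↔ face d = o := by
  obtain ⟨d, hd⟩ | h := G.outer_isFace
  · refine ⟨face d, fun e => ?_⟩
    rw [hd, eq_comm, face_eq_iff]
    rfl
  · exact (not_isEmpty_of_nonempty _ h.1).elim

/-- The outer face of a graph with at least one edge. -/
noncomputable def outerFace [Nonempty G.Dart] : G.Face := (exists_outer_eq (G := G)).choose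

theorem mem_outer_iff [Nonempty G.Dart] {d : G.Dart} : d ∈ G.outer ↔ face d = outerFace :=
  (exists_outer_eq (G := G)).choose_spec d

theorem exists_face_eq_outerFace_source [Nonempty G.Dart] :
    ∃ d : G.Dart, face d = outerFace ∧ d.fst = G.s := by
  obtain ⟨d, hd, h⟩ | h := G.s_outer
  · exact ⟨d, mem_outer_iff.1 hd, h⟩
  · exact (not_isEmpty_of_nonempty _ h).elim

theorem exists_face_eq_outerFace_sink [Nonempty G.Dart] :
    ∃ d : G.Dart, face d = outerFace ∧ d.fst = G.t := by
  obtain ⟨d, hd, h⟩ | h := G.t_outer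
  · exact ⟨d, mem_outer_iff.1 hd, h⟩
  · exact (not_isEmpty_of_nonempty _ h).elim

/-- A nonnegative cocycle that avoids the outer face vanishes. -/
theorem vertexDiff_eq_zero_of_nonneg [Finite V] [Nonempty G.Dart] {ψ : V → ℚ}
    (h0 : 0 ≤ G.vertexDiff ψ)
    (ho : ∀ e : G.Edge, face e.1 = outerFace ∨ face e.1.symm = outerFace →
      G.vertexDiff ψ e = 0) : G.vertexDiff ψ = 0 := by
  have hmono : ∀ u v, G.HasPath u v → ψ u ≤ ψ v := by
    intro u v h
    induction h with
    | refl => rfl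
    | tail _ hvw ih => exact ih.trans (sub_nonneg.1 (h0 ⟨G.dart hvw, hvw⟩))
  have hstep : ∀ d : G.Dart, face d = outerFace → ψ d.fst = ψ d.snd := by
    intro d hd
    by_cases hdo : Out d
    · exact (sub_eq_zero.1 (ho ⟨d, hdo⟩ (Or.inl hd))).symm
    · exact sub_eq_zero.1 (ho ⟨d.symm, out_symm_iff.2 hdo⟩ (Or.inr (by simpa using hd)))
  -- `ψ` is constant along the outer face, which contains `s` and `t`. Every edge lies on a directed
  -- path from `s` to `t`, along which the monotone `ψ` must then be constant too.
  have hst : ψ G.s = ψ G.t := by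
    obtain ⟨d, hd, hds⟩ := exists_face_eq_outerFace_source (G := G)
    obtain ⟨e, he, het⟩ := exists_face_eq_outerFace_sink (G := G)
    rw [← hds, ← het]
    obtain ⟨n, rfl⟩ := (face_eq_iff.1 (hd.trans he.symm)).exists_nat_pow_eq
    clear het
    induction n with
    | zero => rfl
    | succ n ih =>
      rw [pow_succ', Equiv.Perm.mul_apply, face_faceNext] at he
      rw [pow_succ', Equiv.Perm.mul_apply, fst_faceNext, ← hstep _ he]
      exact ih he
  ext e
  have h1 := hmono _ _ (hasPath_source e.1.fst)
  have h2 := hmono _ _ (hasPath_sink e.1.snd)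
  have h3 := h0 e
  rw [vertexDiff_apply] at h3 ⊢
  simp only [Pi.zero_apply] at h3 ⊢
  linarith

/-- The inner faces `f` and `g` are on the left and on the right of some edge. -/
def FaceAdj [Nonempty G.Dart] (f g : G.Face) : Prop :=
  ∃ d : G.Dart, Out d ∧ face d = f ∧ face d.symm = g ∧ f ≠ outerFace ∧ g ≠ outerFace

theorem exists_chain_of_transGen_faceAdj [Finite V] [Nonempty G.Dart] {f g : G.Face}
    (h : Relation.TransGen FaceAdj f g) : ∃ c : G.Edge → ℚ, 0 ≤ c ∧ c ≠ 0 ∧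
      (∀ φ, c ⬝ᵥ G.faceDiff φ = φ f - φ g) ∧
      ∀ e : G.Edge, face e.1 = outerFace ∨ face e.1.symm = outerFace → c e = 0 := by
  classical
  have single : ∀ f g : G.Face, FaceAdj f g → ∃ c : G.Edge → ℚ, 0 ≤ c ∧ c ≠ 0 ∧
      (∀ φ, c ⬝ᵥ G.faceDiff φ = φ f - φ g) ∧
      ∀ e : G.Edge, face e.1 = outerFace ∨ face e.1.symm = outerFace → c e = 0 := by
    rintro f g ⟨d, hd, rfl, rfl, h1, h2⟩
    refine ⟨Pi.single ⟨d, hd⟩ 1, ?_, ?_, ?_, ?_⟩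
    · exact Pi.single_nonneg.2 zero_le_one
    · exact fun h => one_ne_zero ((Pi.single_eq_zero_iff).1 h)
    · intro φ
      rw [single_one_dotProduct]
      rfl
    · intro e he
      refine Pi.single_eq_of_ne ?_ _
      rintro rfl
      exact he.elim h1 h2
  induction h with
  | single h => exact single _ _ h
  | @tail b g _ h ih =>
    obtain ⟨c, h1, h2, h3, h4⟩ := ih
    obtain ⟨c', h1', h2', h3', h4'⟩ := single _ _ h
    refine ⟨c + c', add_nonneg h1 h1', ?_, ?_, ?_⟩
    · exact ((lt_of_le_of_ne h1 h2.symm).trans_le (le_add_of_nonneg_right h1')).ne'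
    · intro φ
      rw [add_dotProduct, h3, h3']
      ring
    · intro e he
      rw [Pi.add_apply, h4 e he, h4' e he, add_zero]

/-- A closed dual walk counts the edges it crosses with nonnegative multiplicities. This chain is
orthogonal to all `faceDiff φ`, hence a coboundary, and it avoids the outer face, so it vanishes. -/
theorem not_transGen_faceAdj [Finite V] [Nonempty G.Dart] (f : G.Face) :
    ¬ Relation.TransGen FaceAdj f f := by
  intro h
  obtain ⟨c, h1, h2, h3, h4⟩ := exists_chain_of_transGen_faceAdj h
  obtain ⟨ψ, rfl⟩ := exists_eq_vertexDiff fun φ => (h3 φ).trans (sub_self _)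
  exact h2 (vertexDiff_eq_zero_of_nonneg h1 h4)

theorem wellFounded_faceAdj [Finite V] [Nonempty G.Dart] :
    WellFounded (FaceAdj : G.Face → G.Face → Prop) := by
  have : IsTrans G.Face (Relation.TransGen FaceAdj) := ⟨fun _ _ _ => .trans⟩
  have : Std.Irrefl (Relation.TransGen (FaceAdj : G.Face → G.Face → Prop)) :=
    ⟨not_transGen_faceAdj⟩
  exact (Finite.wellFounded_of_trans_of_irrefl (Relation.TransGen FaceAdj)).mono
    fun _ _ => .single

theorem wellFounded_faceAdj_swap [Finite V] [Nonempty G.Dart] :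
    WellFounded (Function.swap FaceAdj : G.Face → G.Face → Prop) := by
  have : IsTrans G.Face (Function.swap (Relation.TransGen FaceAdj)) :=
    ⟨fun _ _ _ h h' => Relation.TransGen.trans h' h⟩
  have : Std.Irrefl (Function.swap (Relation.TransGen (FaceAdj : G.Face → G.Face → Prop))) :=
    ⟨not_transGen_faceAdj⟩
  exact (Finite.wellFounded_of_trans_of_irrefl (Function.swap (Relation.TransGen FaceAdj))).mono
    fun _ _ h => Relation.TransGen.single (r := FaceAdj) h

end EmbeddedPlanarSTGraph

/-! ### Acyclicity of the augmented graph -/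

namespace EmbeddedPlanarSTGraph

variable {V : Type*} {G : EmbeddedPlanarSTGraph V}

theorem exists_faceNext_pow_eq [Finite V] (k : G.Dart) :
    ∃ n, (G.rot.faceNext ^ n) (G.rot.faceNext (G.rot.next k)) = k.symm :=
  (face_eq_iff.1 ((face_faceNext _).trans (face_next k))).exists_nat_pow_eq

/-- If there is no path from the end of `k` to the end of the next outgoing dart, then the face
between them has a further edge on its right boundary. -/
theorem IsSourceCorner.exists_out_ne [Finite V] {k : G.Dart} (hk : IsSourceCorner k)
    (h : ¬ G.HasPath k.snd (G.rot.next k).snd) :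
    ∃ e, Out e ∧ face e = face (G.rot.next k) ∧ e ≠ G.rot.next k := by
  classical
  by_contra! H
  refine h ?_
  have hex := exists_faceNext_pow_eq k
  -- The traversal is followed from just after `next k` to the first visit of `k.symm`, which
  -- directly precedes `next k`. If `next k` is the only forward dart, this whole stretch runs
  -- backwards along a directed path.
  have key := hasPath_of_forall_not_out (d := G.rot.faceNext (G.rot.next k)) (n := Nat.find hex)
    fun j hj hout => ?_
  · rwa [Nat.find_spec hex, fst_faceNext] at key
  · have hface : face ((G.rot.faceNext ^ j) (G.rot.faceNext (G.rot.next k))) =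
        face (G.rot.next k) := by
      rw [← face_faceNext (G.rot.next k)]
      exact face_eq_iff.2 (Equiv.Perm.SameCycle.symm ⟨j, by simp⟩)
    have heq := H _ hout hface
    have hnext : G.rot.next k = G.rot.faceNext k.symm := by
      rw [faceNext_apply, SimpleGraph.Dart.symm_symm]
    cases j with
    | zero =>
      have h1 : G.rot.next k = k.symm := G.rot.faceNext.injective (heq.trans hnext)
      exact hk.1.not_symm (h1 ▸ hk.2)
    | succ j =>
      rw [pow_succ', Equiv.Perm.mul_apply] at heq
      exact Nat.find_min hex (Nat.lt_of_succ_lt hj)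
        (G.rot.faceNext.injective (heq.trans hnext))

/-- If there is no path to the end of `k` from the end of the next outgoing dart, then the face
between them has a further edge on its left boundary. -/
theorem exists_not_out_ne [Finite V] {k : G.Dart}
    (h : ¬ G.HasPath (G.rot.next k).snd k.snd) :
    ∃ e, ¬ Out e ∧ face e = face (G.rot.next k) ∧ e ≠ k.symm := by
  classical
  by_contra! H
  refine h ?_
  have hex := exists_faceNext_pow_eq k
  have key := hasPath_of_forall_out (d := G.rot.faceNext (G.rot.next k)) (n := Nat.find hex)
    fun j hj => ?_
  · rwa [Nat.find_spec hex, fst_faceNext] at key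
  · by_contra hout
    refine Nat.find_min hex hj (H _ hout ?_)
    rw [← face_faceNext (G.rot.next k)]
    exact face_eq_iff.2 (Equiv.Perm.SameCycle.symm ⟨j, by simp⟩)

/-- The edges of `G` together with edges between consecutive successors: from left to right at
the corners in `P`, and from right to left at the corners in `Q`. -/
def AugAdj (P Q : G.Dart → Prop) (v w : V) : Prop :=
  G.graph.Adj v w ∨ (∃ k, P k ∧ v = k.snd ∧ w = (G.rot.next k).snd) ∨
    ∃ k, Q k ∧ v = (G.rot.next k).snd ∧ w = k.snd

/-- The added edges lie in inner faces, at most one in each face, and no single one of them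
closes a directed cycle. -/
structure IsAdmissible [Nonempty G.Dart] (P Q : G.Dart → Prop) : Prop where
  isSourceCorner : ∀ k, P k ∨ Q k → IsSourceCorner k
  inner : ∀ k, P k ∨ Q k → face (G.rot.next k) ≠ outerFace
  not_hasPath_of_left : ∀ k, P k → ¬ G.HasPath (G.rot.next k).snd k.snd
  not_hasPath_of_right : ∀ k, Q k → ¬ G.HasPath k.snd (G.rot.next k).snd
  disjoint : ∀ k, P k → ¬ Q k

/-- The chain of a walk: `C` counts the edges of `G`, and `σ` the added edges, with a sign. -/
theorem exists_chain_of_transGen_augAdj [Finite V] {P Q : G.Dart → Prop}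
    (hPQ : ∀ k, P k → ¬ Q k) {x y : V} (h : Relation.TransGen (AugAdj P Q) x y) :
    ∃ (C : G.Edge → ℚ) (σ : G.Dart → ℚ), 0 ≤ C ∧ (∀ k, 0 < σ k → P k) ∧ (∀ k, σ k < 0 → Q k) ∧
      (C ≠ 0 ∨ ∃ k, σ k ≠ 0) ∧ ∀ ψ : V → ℚ, C ⬝ᵥ G.vertexDiff ψ +
        ∑ k, σ k * (ψ (G.rot.next k).snd - ψ k.snd) = ψ y - ψ x := by
  classical
  have single : ∀ x y, AugAdj P Q x y → ∃ (C : G.Edge → ℚ) (σ : G.Dart → ℚ), 0 ≤ C ∧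
      (∀ k, 0 < σ k → P k) ∧ (∀ k, σ k < 0 → Q k) ∧
      (C ≠ 0 ∨ ∃ k, σ k ≠ 0) ∧ ∀ ψ : V → ℚ, C ⬝ᵥ G.vertexDiff ψ +
        ∑ k, σ k * (ψ (G.rot.next k).snd - ψ k.snd) = ψ y - ψ x := by
    rintro x y (h | ⟨k, hk, rfl, rfl⟩ | ⟨k, hk, rfl, rfl⟩)
    · refine ⟨Pi.single ⟨G.dart h, h⟩ 1, 0, Pi.single_nonneg.2 zero_le_one, by simp, by simp,
        Or.inl fun h => one_ne_zero (Pi.single_eq_zero_iff.1 h), fun ψ => ?_⟩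
      rw [single_one_dotProduct]
      simp only [Pi.zero_apply, zero_mul, Finset.sum_const_zero, add_zero]
      rfl
    · refine ⟨0, Pi.single k 1, le_rfl, fun j hj => ?_, fun j hj => ?_, Or.inr ⟨k, by simp⟩,
        fun ψ => ?_⟩
      · by_cases hjk : j = k
        · exact hjk ▸ hk
        · simp [hjk] at hj
      · exact (hj.not_ge ((Pi.single_nonneg.2 zero_le_one : (0 : G.Dart → ℚ) ≤ _) j)).elim
      · rw [zero_dotProduct, zero_add]
        simp [Pi.single_apply]
    · refine ⟨0, -Pi.single k 1, le_rfl, fun j hj => ?_, fun j hj => ?_, Or.inr ⟨k, by simp⟩,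
        fun ψ => ?_⟩
      · exact ((neg_pos.1 hj).not_ge
          ((Pi.single_nonneg.2 zero_le_one : (0 : G.Dart → ℚ) ≤ _) j)).elim
      · by_cases hjk : j = k
        · exact hjk ▸ hk
        · simp [hjk] at hj
      · rw [zero_dotProduct, zero_add]
        simp [Pi.single_apply]
  induction h with
  | single h => exact single _ _ h
  | @tail y z _ h ih =>
    obtain ⟨C, σ, h1, h2, h3, h4, h5⟩ := ih
    obtain ⟨C', σ', h1', h2', h3', -, h5'⟩ := single _ _ h
    refine ⟨C + C', σ + σ', add_nonneg h1 h1', fun k hk => ?_, fun k hk => ?_, ?_, fun ψ => ?_⟩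
    · by_contra hPk
      have := mt (h2 k) hPk
      have := mt (h2' k) hPk
      rw [Pi.add_apply] at hk
      linarith
    · by_contra hQk
      have := mt (h3 k) hQk
      have := mt (h3' k) hQk
      rw [Pi.add_apply] at hk
      linarith
    · rcases h4 with h4 | ⟨k, hk⟩
      · exact Or.inl ((lt_of_le_of_ne h1 h4.symm).trans_le (le_add_of_nonneg_right h1')).ne'
      -- Nothing cancels: as `P` and `Q` are disjoint, `σ k` and `σ' k` cannot have opposite signs.
      · refine Or.inr ⟨k, ?_⟩
        rw [Pi.add_apply]
        rcases hk.lt_or_gt with hk | hk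
        · have := mt (h2' k) fun hP => hPQ k hP (h3 k hk)
          linarith
        · have := mt (h3' k) (hPQ k (h2 k hk))
          linarith
    · rw [add_dotProduct]
      simp only [Pi.add_apply, add_mul, Finset.sum_add_distrib]
      linarith [h5 ψ, h5' ψ]

/-- An added edge `v → w` is homologous to the path that goes back from `v` to the common
predecessor and on to `w`. -/
theorem sum_corner_eq_dotProduct [Finite V] {σ : G.Dart → ℚ}
    (hσ : ∀ k, σ k ≠ 0 → IsSourceCorner k) (ψ : V → ℚ) :
    ∑ k, σ k * (ψ (G.rot.next k).snd - ψ k.snd) =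
      (fun e : G.Edge => σ (G.rot.next.symm e.1) - σ e.1) ⬝ᵥ G.vertexDiff ψ := by
  have h1 : ∑ k, σ k * (ψ (G.rot.next k).snd - ψ (G.rot.next k).fst) =
      ∑ k : G.Dart, σ (G.rot.next.symm k) * (ψ k.snd - ψ k.fst) := by
    rw [← Equiv.sum_comp G.rot.next
      fun k : G.Dart => σ (G.rot.next.symm k) * (ψ k.snd - ψ k.fst)]
    simp
  have h2 : ∑ k, σ k * (ψ (G.rot.next k).snd - ψ k.snd) =
      ∑ k : G.Dart, (σ (G.rot.next.symm k) - σ k) * (ψ k.snd - ψ k.fst) := by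
    simp only [sub_mul, Finset.sum_sub_distrib]
    rw [← h1, ← Finset.sum_sub_distrib]
    refine Finset.sum_congr rfl fun k _ => ?_
    rw [G.rot.fst_next]
    ring
  rw [h2, sum_dart]
  refine Finset.sum_congr rfl fun e _ => ?_
  have h3 : σ e.1.symm = 0 := by
    by_contra h
    exact e.2.not_symm (hσ _ h).1
  have h4 : σ (G.rot.next.symm e.1.symm) = 0 := by
    by_contra h
    have := (hσ _ h).2
    rw [Equiv.apply_symm_apply] at this
    exact e.2.not_symm this
  rw [h3, h4, sub_zero, zero_mul, add_zero, vertexDiff_apply]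

/-- The potentials of the parts of the face `f`, which may be split by an added edge. -/
def IsPotential (σ : G.Dart → ℚ) (φ : G.Face → ℚ) (f : G.Face) (a : ℚ) : Prop :=
  a = φ f ∨ ∃ k, IsSourceCorner k ∧ face (G.rot.next k) = f ∧ a = φ f - σ k

theorem isPotential_left {σ : G.Dart → ℚ} (φ : G.Face → ℚ)
    (hσ : ∀ k, σ k ≠ 0 → IsSourceCorner k) (d : G.Dart) :
    IsPotential σ φ (face d) (φ (face d) - σ (G.rot.next.symm d)) := by
  by_cases h : σ (G.rot.next.symm d) = 0
  · exact Or.inl (by rw [h, sub_zero])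
  · exact Or.inr ⟨_, hσ _ h, by rw [Equiv.apply_symm_apply], rfl⟩

theorem isPotential_right {σ : G.Dart → ℚ} (φ : G.Face → ℚ)
    (hσ : ∀ k, σ k ≠ 0 → IsSourceCorner k) (d : G.Dart) :
    IsPotential σ φ (face d.symm) (φ (face d.symm) - σ d) := by
  by_cases h : σ d = 0
  · exact Or.inl (by rw [h, sub_zero])
  · exact Or.inr ⟨_, hσ _ h, face_next d, rfl⟩

theorem IsPotential.eq_of_outerFace [Nonempty G.Dart] {σ : G.Dart → ℚ} {φ : G.Face → ℚ}
    (hσ : ∀ k, σ k ≠ 0 → face (G.rot.next k) ≠ outerFace)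
    {a : ℚ} (h : IsPotential σ φ outerFace a) : a = φ outerFace := by
  rcases h with rfl | ⟨k, -, hk, rfl⟩
  · rfl
  · rw [by_contra fun h => hσ k h hk, sub_zero]

section

variable [Finite V] [Nonempty G.Dart] {P Q : G.Dart → Prop} {σ : G.Dart → ℚ} {φ : G.Face → ℚ}

/-- A minimum principle: crossing an edge from left to right does not increase the potential, and
the dual order makes this descent end at the outer face, which no added edge cuts. -/
theorem IsAdmissible.outerFace_le (h : IsAdmissible P Q) (hP : ∀ k, 0 < σ k → P k)
    (hQ : ∀ k, σ k < 0 → Q k)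
    (hφ : ∀ d, Out d → φ (face d.symm) - σ d ≤ φ (face d) - σ (G.rot.next.symm d))
    (f : G.Face) {a : ℚ} (ha : IsPotential σ φ f a) : φ outerFace ≤ a := by
  have hσ : ∀ k, σ k ≠ 0 → P k ∨ Q k := fun k hk =>
    hk.lt_or_gt.elim (fun h => Or.inr (hQ k h)) fun h => Or.inl (hP k h)
  have hσc : ∀ k, σ k ≠ 0 → IsSourceCorner k := fun k hk => h.isSourceCorner k (hσ k hk)
  induction f using (wellFounded_faceAdj_swap (G := G)).induction generalizing a with
  | _ f ih =>
    by_cases hf : f = outerFace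
    · subst hf
      exact (ha.eq_of_outerFace fun k hk => h.inner k (hσ k hk)).ge
    have step : ∀ d, Out d → face d = f →
        φ outerFace ≤ φ (face d) - σ (G.rot.next.symm d) := by
      intro d hd hdf
      refine le_trans ?_ (hφ d hd)
      have hr := isPotential_right φ hσc d
      by_cases ho : face d.symm = outerFace
      · rw [ho] at hr ⊢
        exact (hr.eq_of_outerFace fun k hk => h.inner k (hσ k hk)).ge
      · exact ih _ ⟨d, hd, hdf, rfl, hf, ho⟩ hr
    have hcorner : ∀ k, IsSourceCorner k → face (G.rot.next k) = f →
        φ outerFace ≤ φ f - σ k := by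
      intro k hk hkf
      have := step _ hk.2 hkf
      rwa [Equiv.symm_apply_apply, hkf] at this
    rcases ha with rfl | ⟨k, hk, hkf, rfl⟩
    · obtain ⟨k, hk, hkf⟩ := exists_isSourceCorner f
      rcases le_or_gt 0 (σ k) with hs | hs
      -- The lower part always has `next k` on its right boundary. For `σ k ≥ 0` the upper part has
      -- at least the same potential; for `σ k < 0` it needs a right boundary edge `e` of its own,
      -- which exists because no path leads from `k.snd` to `(next k).snd`.
      · exact (hcorner k hk hkf).trans (sub_le_self _ hs)
      · obtain ⟨e, heo, hef, hek⟩ := hk.exists_out_ne (h.not_hasPath_of_right k (hQ k hs))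
        have hs0 : σ (G.rot.next.symm e) = 0 := by
          by_contra hne
          have h1 := (hσc _ hne).eq_of_face_eq hk (by rw [Equiv.apply_symm_apply, hef])
          exact hek (by rw [← h1, Equiv.apply_symm_apply])
        have := step e heo (hef.trans hkf)
        rwa [hs0, sub_zero, hef, hkf] at this
    · exact hcorner k hk hkf

theorem IsAdmissible.le_outerFace (h : IsAdmissible P Q) (hP : ∀ k, 0 < σ k → P k)
    (hQ : ∀ k, σ k < 0 → Q k)
    (hφ : ∀ d, Out d → φ (face d.symm) - σ d ≤ φ (face d) - σ (G.rot.next.symm d))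
    (f : G.Face) {a : ℚ} (ha : IsPotential σ φ f a) : a ≤ φ outerFace := by
  have hσ : ∀ k, σ k ≠ 0 → P k ∨ Q k := fun k hk =>
    hk.lt_or_gt.elim (fun h => Or.inr (hQ k h)) fun h => Or.inl (hP k h)
  have hσc : ∀ k, σ k ≠ 0 → IsSourceCorner k := fun k hk => h.isSourceCorner k (hσ k hk)
  induction f using (wellFounded_faceAdj (G := G)).induction generalizing a with
  | _ f ih =>
    by_cases hf : f = outerFace
    · subst hf
      exact (ha.eq_of_outerFace fun k hk => h.inner k (hσ k hk)).le
    have step : ∀ d, Out d → face d.symm = f → φ (face d.symm) - σ d ≤ φ outerFace := by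
      intro d hd hdf
      refine (hφ d hd).trans ?_
      have hl := isPotential_left φ hσc d
      by_cases ho : face d = outerFace
      · rw [ho] at hl ⊢
        exact (hl.eq_of_outerFace fun k hk => h.inner k (hσ k hk)).le
      · exact ih _ ⟨d, hd, rfl, hdf, ho, hf⟩ hl
    have hcorner : ∀ k, IsSourceCorner k → face (G.rot.next k) = f →
        φ f - σ k ≤ φ outerFace := by
      intro k hk hkf
      rw [face_next] at hkf
      have := step _ hk.1 hkf
      rwa [hkf] at this
    rcases ha with rfl | ⟨k, hk, hkf, rfl⟩
    · obtain ⟨k, hk, hkf⟩ := exists_isSourceCorner f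
      rcases le_or_gt (σ k) 0 with hs | hs
      · have := hcorner k hk hkf
        linarith
      -- Here the bound on the lower part is too weak, so the upper part is left through a further
      -- edge of the left boundary.
      · obtain ⟨e, heo, hef, hek⟩ := exists_not_out_ne (h.not_hasPath_of_left k (hP k hs))
        have hs0 : σ e.symm = 0 := by
          by_contra hne
          have h1 := (hσc _ hne).eq_of_face_eq hk
            (by rw [face_next, SimpleGraph.Dart.symm_symm, hef])
          exact hek (by rw [← h1, SimpleGraph.Dart.symm_symm])
        have := step e.symm (out_symm_iff.2 heo)
          (by rw [SimpleGraph.Dart.symm_symm, hef, hkf])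
        rwa [hs0, sub_zero, SimpleGraph.Dart.symm_symm, hef, hkf] at this
    · exact hcorner k hk hkf

/-- Adding an admissible set of edges to a planar `st`-graph keeps it acyclic. -/
theorem IsAdmissible.not_transGen_augAdj (h : IsAdmissible P Q) (x : V) :
    ¬ Relation.TransGen (AugAdj P Q) x x := by
  intro hx
  obtain ⟨C, σ, hC, hP, hQ, hne, hsum⟩ := exists_chain_of_transGen_augAdj h.disjoint hx
  have hσ : ∀ k, σ k ≠ 0 → IsSourceCorner k := fun k hk => h.isSourceCorner k
    (hk.lt_or_gt.elim (fun h => Or.inr (hQ k h)) fun h => Or.inl (hP k h))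
  obtain ⟨φ, hφ⟩ := exists_eq_faceDiff
    (c := C + fun e : G.Edge => σ (G.rot.next.symm e.1) - σ e.1) fun ψ => by
      rw [add_dotProduct, ← sum_corner_eq_dotProduct hσ, hsum, sub_self]
  have hφe : ∀ e : G.Edge,
      C e + (σ (G.rot.next.symm e.1) - σ e.1) = φ (face e.1) - φ (face e.1.symm) :=
    fun e => congrFun hφ e
  have hle : ∀ d, Out d → φ (face d.symm) - σ d ≤ φ (face d) - σ (G.rot.next.symm d) := by
    intro d hd
    have h1 := hφe ⟨d, hd⟩
    have h2 := hC ⟨d, hd⟩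
    simp only [Pi.zero_apply] at h1 h2
    linarith
  have hpot : ∀ f a, IsPotential σ φ f a → a = φ outerFace := fun f a ha =>
    le_antisymm (h.le_outerFace hP hQ hle f ha) (h.outerFace_le hP hQ hle f ha)
  rcases hne with hne | ⟨k, hk⟩
  · refine hne (funext fun e => ?_)
    have h1 := hpot _ _ (isPotential_left φ hσ e.1)
    have h2 := hpot _ _ (isPotential_right φ hσ e.1)
    have h3 := hφe e
    rw [Pi.zero_apply]
    linarith
  -- The two parts of the face cut at `k` have equal potentials, which differ by `σ k`.
  · have h1 := hpot _ _ (Or.inl rfl : IsPotential σ φ (face (G.rot.next k)) _)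
    have h2 := hpot _ _ (Or.inr ⟨k, hσ k hk, rfl, rfl⟩ :
      IsPotential σ φ (face (G.rot.next k)) (φ (face (G.rot.next k)) - σ k))
    exact hk (by linarith)

end

end EmbeddedPlanarSTGraph

/-! ### Orbits as lists, and topological numberings -/

theorem List.nodup_iterate_minimalPeriod {α : Type*} (f : α → α) (a : α) :
    (List.iterate f a (Function.minimalPeriod f a)).Nodup := by
  rw [List.nodup_iff_injective_get]
  intro i j h
  simp only [List.get_eq_getElem, List.getElem_iterate] at h
  have hi := i.2.trans_eq (List.length_iterate ..)
  have hj := j.2.trans_eq (List.length_iterate ..)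
  exact Fin.ext (Function.iterate_injOn_Iio_minimalPeriod hi hj h)

theorem List.isChain_iterate {α : Type*} (f : α → α) (a : α) (n : ℕ) :
    (List.iterate f a n).IsChain fun x y => f x = y := by
  rw [List.isChain_iff_getElem]
  intro i hi
  rw [List.getElem_iterate, List.getElem_iterate, Function.iterate_succ_apply']

/-- If an orbit leaves the set `p` at most once, then its elements in `p` are consecutive. -/
theorem List.isChain_filter_iterate {α : Type*} (f : α → α) (p : α → Prop) [DecidablePred p]
    (a : α) (n : ℕ) (hnd : (List.iterate f a n).Nodup) (hn : ¬ p (f^[n] a))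
    (hu : ∀ x ∈ List.iterate f a n, ∀ y ∈ List.iterate f a n,
      p x → ¬ p (f x) → p y → ¬ p (f y) → x = y) :
    ((List.iterate f a n).filter p).IsChain fun x y => f x = y := by
  induction n generalizing a with
  | zero => exact .nil
  | succ n ih =>
    rw [List.iterate] at hnd hu ⊢
    rw [List.nodup_cons] at hnd
    have hrest := ih (f a) hnd.2 hn fun x hx y hy =>
      hu x (List.mem_cons_of_mem _ hx) y (List.mem_cons_of_mem _ hy)
    by_cases ha : p a
    · rw [List.filter_cons_of_pos (by simpa using ha), List.isChain_cons]
      refine ⟨fun y hy => ?_, hrest⟩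
      by_cases hfa : p (f a)
      · cases n with
        | zero => exact (hn hfa).elim
        | succ n =>
          rw [List.iterate, List.filter_cons_of_pos (by simpa using hfa)] at hy
          simpa using hy
      -- The orbit leaves `p` right after `a`. A later element `y` in `p` would force a second exit,
      -- since the orbit ends outside `p`; by uniqueness that exit is `a` again, against `Nodup`.
      · exfalso
        have hy' := List.mem_of_mem_head? hy
        rw [List.mem_filter, List.mem_iterate] at hy'
        obtain ⟨⟨m, hm, rfl⟩, hpy⟩ := hy'
        have hpy : p (f^[m] (f a)) := by simpa using hpy
        obtain ⟨j, hj, hpj, hpj'⟩ : ∃ j < n, p (f^[j] (f a)) ∧ ¬ p (f (f^[j] (f a))) := by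
          by_contra! H
          refine hn (Nat.le_induction (P := fun k _ => k ≤ n → p (f^[k] (f a))) (fun _ => hpy)
            (fun k _ ihk hkn => ?_) n hm.le le_rfl)
          rw [Function.iterate_succ_apply']
          exact H k hkn (ihk (by omega))
        have hmem : f^[j] (f a) ∈ List.iterate f (f a) n := List.mem_iterate.2 ⟨j, hj, rfl⟩
        have := hu _ (List.mem_cons_of_mem _ hmem) a List.mem_cons_self hpj hpj' ha hfa
        rw [this] at hmem
        exact hnd.1 hmem
    · rwa [List.filter_cons_of_neg (by simpa using ha)]

/-- An acyclic relation on a finite type has a topological numbering. -/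
theorem exists_topological_numbering {α : Type*} [Finite α] (r : α → α → Prop)
    (hr : ∀ a, ¬ Relation.TransGen r a a) :
    ∃ π : α → ℕ, Set.BijOn π Set.univ (Set.Icc 1 (Nat.card α)) ∧ ∀ a b, r a b → π a < π b := by
  let _ : PartialOrder α :=
    { le := Relation.ReflTransGen r
      le_refl := fun _ => .refl
      le_trans := fun _ _ _ => .trans
      le_antisymm := fun a b h h' => by
        rcases h.cases_head with h | ⟨c, hc, hcb⟩
        · exact h
        · exact (hr a (.head' hc (hcb.trans h'))).elim }
  have : Fintype (LinearExtension α) := Fintype.ofFinite α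
  let e := (Fintype.orderIsoFinOfCardEq (LinearExtension α) rfl).symm
  have hcard : Fintype.card (LinearExtension α) = Nat.card α := Nat.card_eq_fintype_card.symm
  refine ⟨fun a => e (toLinearExtension a) + 1, ⟨fun a _ => ?_, fun a _ b _ h => ?_, ?_⟩, ?_⟩
  · have := (e (toLinearExtension a)).2
    simp only [Set.mem_Icc]
    omega
  · exact e.injective (Fin.ext (Nat.succ_injective h))
  · rintro k ⟨hk, hk'⟩
    refine ⟨e.symm ⟨k - 1, by omega⟩, trivial, ?_⟩
    have : e (toLinearExtension (e.symm ⟨k - 1, by omega⟩ : α)) = ⟨k - 1, by omega⟩ :=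
      e.apply_symm_apply _
    simp only [this]
    omega
  · intro a b h
    have hab : a ≠ b := by
      rintro rfl
      exact hr a (.single h)
    have h1 : toLinearExtension a ≤ toLinearExtension b :=
      toLinearExtension.monotone (.single h : Relation.ReflTransGen r a b)
    have h2 : toLinearExtension a < toLinearExtension b := lt_of_le_of_ne h1 hab
    have := e.strictMono h2
    simpa using this

/-! ### Successor lists, peaks, and the bitonic ordering -/

namespace EmbeddedPlanarSTGraph

variable {V : Type*} {G : EmbeddedPlanarSTGraph V}

theorem fst_next_iterate (d : G.Dart) (n : ℕ) : (G.rot.next^[n] d).fst = d.fst := by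
  induction n with
  | zero => rfl
  | succ n ih => rw [Function.iterate_succ_apply', G.rot.fst_next, ih]

theorem isSourceCorner_of_next_fst_eq_source {k : G.Dart} (h : (G.rot.next k).fst = G.s) :
    IsSourceCorner k :=
  ⟨out_of_fst_eq_source (by rwa [G.rot.fst_next] at h), out_of_fst_eq_source h⟩

/-- All darts at `s` are outgoing, so the corner of the outer face at `s` is a source corner, and a
face has only one. -/
theorem IsSourceCorner.fst_eq_source [Finite V] [Nonempty G.Dart] {k : G.Dart}
    (hk : IsSourceCorner k) (h : face (G.rot.next k) = outerFace) : k.fst = G.s := by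
  obtain ⟨d, hd, hds⟩ := exists_face_eq_outerFace_source (G := G)
  have h0 : IsSourceCorner (G.rot.next.symm d) :=
    isSourceCorner_of_next_fst_eq_source (by rwa [Equiv.apply_symm_apply])
  rw [hk.eq_of_face_eq h0 (by rw [h, Equiv.apply_symm_apply, hd]), ← hds, ← G.rot.fst_next,
    Equiv.apply_symm_apply]

/-- The successor list is given by outgoing edges which follow one another in clockwise order
and enclose inner faces. -/
theorem exists_list_dart [Finite V] [Nonempty G.Dart] (u : V) :
    ∃ L : List G.Dart, G.succList u = L.map (fun d => d.snd) ∧ L.Nodup ∧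
      (∀ k ∈ L, k.fst = u ∧ Out k) ∧
      ∀ i (h : i + 1 < L.length), G.rot.next L[i] = L[i + 1] ∧ face L[i + 1] ≠ outerFace := by
  classical
  by_cases hu : ∃ d, G.IsStartDart u d
  swap
  · exact ⟨[], by rw [succList, dif_neg hu]; rfl, List.nodup_nil, by simp, by simp⟩
  set d := hu.choose with hd
  obtain ⟨hdu, hstart⟩ := hu.choose_spec
  rw [← hd] at hdu hstart
  have hnd := List.nodup_iterate_minimalPeriod G.rot.next d
  have hfst : ∀ k ∈ List.iterate G.rot.next d (Function.minimalPeriod G.rot.next d),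
      k.fst = u := by
    intro k hk
    obtain ⟨m, -, rfl⟩ := List.mem_iterate.1 hk
    rw [fst_next_iterate, hdu]
  set L := (List.iterate G.rot.next d (Function.minimalPeriod G.rot.next d)).filter
    fun k => G.graph.Adj k.fst k.snd with hL
  have hLnd : L.Nodup := hnd.filter _
  have hLmem : ∀ k ∈ L, k.fst = u ∧ Out k := by
    intro k hk
    rw [hL, List.mem_filter] at hk
    exact ⟨hfst k hk.1, of_decide_eq_true hk.2⟩
  refine ⟨L, by rw [succList, dif_pos hu]; rfl, hLnd, hLmem, ?_⟩
  -- If the corner between `L[i]` and `L[i + 1]` were in the outer face, it would be the source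
  -- corner at `s` that directly precedes the start dart `d = L[0]`; then `L[i + 1] = L[0]`, against
  -- `Nodup`.
  suffices H : L.IsChain (fun x y => G.rot.next x = y) ∧
      (u = G.s → face d = outerFace ∧ ∀ h : 0 < L.length, L[0] = d) by
    intro i hi
    have h1 := List.isChain_iff_getElem.1 H.1 i hi
    refine ⟨h1, fun ho => ?_⟩
    have hk : IsSourceCorner L[i] :=
      ⟨(hLmem _ (List.getElem_mem _)).2, h1 ▸ (hLmem _ (List.getElem_mem _)).2⟩
    have hs := hk.fst_eq_source (h1 ▸ ho)
    rw [(hLmem _ (List.getElem_mem _)).1] at hs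
    obtain ⟨hd1, hd2⟩ := H.2 hs
    have h0 : IsSourceCorner (G.rot.next.symm d) :=
      isSourceCorner_of_next_fst_eq_source (by rw [Equiv.apply_symm_apply, hdu, hs])
    have h2 := hk.eq_of_face_eq h0 (by rw [h1, ho, Equiv.apply_symm_apply, hd1])
    rw [Equiv.eq_symm_apply, h1, ← hd2 (by omega)] at h2
    exact absurd ((hLnd.getElem_inj_iff).1 h2) (by omega)
  rcases hstart with ⟨hs, ho⟩ | ⟨hs, hin⟩
  · have hall : L = List.iterate G.rot.next d (Function.minimalPeriod G.rot.next d) := by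
      refine List.filter_eq_self.2 fun k hk => ?_
      exact decide_eq_true (out_of_fst_eq_source ((hfst k hk).trans hs))
    rw [hall]
    refine ⟨List.isChain_iterate _ _ _, fun _ => ⟨mem_outer_iff.1 ho, fun h => ?_⟩⟩
    rw [List.getElem_iterate]
    rfl
  -- After a full period the rotation is back at the incoming start dart, and the outgoing darts at
  -- `u` end only once around `u`.
  · refine ⟨List.isChain_filter_iterate _ _ _ _ hnd ?_ ?_, fun h => (hs h).elim⟩
    · rw [Function.iterate_minimalPeriod]
      exact out_symm_iff.1 hin
    · intro x hx y hy h1 h2 h3 h4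
      exact last_out_unique h1 h2 h3 h4 ((hfst x hx).trans (hfst y hy).symm)

/-- Without a forbidden configuration there is a position in the successor list at which a
bitonic ordering may have its maximum. -/
theorem exists_peak {u : V} (h : ¬ G.HasForbiddenConfiguration u) (hnd : (G.succList u).Nodup)
    (hne : G.succList u ≠ []) : ∃ h < (G.succList u).length,
      (∀ i, ∀ hi : i + 1 < (G.succList u).length, i < h →
        ¬ G.HasPath (G.succList u)[i + 1] (G.succList u)[i]) ∧
      (∀ i, ∀ hi : i + 1 < (G.succList u).length, h ≤ i →
        ¬ G.HasPath (G.succList u)[i] (G.succList u)[i + 1]) := by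
  classical
  have hpos := List.length_pos_iff.2 hne
  by_cases hex : ∃ i, ∃ hi : i + 1 < (G.succList u).length,
      G.HasPath (G.succList u)[i + 1] (G.succList u)[i]
  -- The peak is the first `i` with a path `v_{i+1} ⇝ v_i`. A path `v_i ⇝ v_{i+1}` at the same index
  -- would contradict acyclicity; one at a later index completes a forbidden configuration.
  · obtain ⟨hi, hpath⟩ := Nat.find_spec hex
    refine ⟨Nat.find hex, by omega, fun i hi' hlt hp => Nat.find_min hex hlt ⟨hi', hp⟩,
      fun i hi' hle hp => ?_⟩
    rcases hle.eq_or_lt with rfl | hlt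
    · exact absurd (hnd.getElem_inj_iff.1 (hp.antisymm hpath)) (by omega)
    · exact h ⟨_, i, hlt, hi', hpath, hp⟩
  · push Not at hex
    exact ⟨(G.succList u).length - 1, by omega, fun i hi _ => hex i hi, fun i hi hle => by omega⟩

theorem exists_augAdj [Finite V] (h : ∀ u : V, ¬ G.HasForbiddenConfiguration u) :
    ∃ r : V → V → Prop, (∀ x, ¬ Relation.TransGen r x x) ∧ (∀ u v, G.graph.Adj u v → r u v) ∧
      ∀ u, G.succList u = [] ∨ ∃ h < (G.succList u).length,
        (∀ i, ∀ hi : i + 1 < (G.succList u).length, i < h →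
          r (G.succList u)[i] (G.succList u)[i + 1]) ∧
        (∀ i, ∀ hi : i + 1 < (G.succList u).length, h ≤ i →
          r (G.succList u)[i + 1] (G.succList u)[i]) := by
  classical
  rcases isEmpty_or_nonempty G.Dart with hD | hD
  · refine ⟨G.graph.Adj, G.acyclic, fun _ _ => id, fun u => Or.inl ?_⟩
    rw [succList, dif_neg fun ⟨d, _⟩ => hD.elim d]
  choose L hL hnd hmem hnext using exists_list_dart (G := G)
  have hlen : ∀ u, (G.succList u).length = (L u).length := fun u => by rw [hL, List.length_map]
  have hget : ∀ u i (hi : i < (G.succList u).length),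
      (G.succList u)[i] = ((L u)[i]'(hlen u ▸ hi)).snd := fun u i hi => by
    simp only [hL, List.getElem_map]
  have hnds : ∀ u, (G.succList u).Nodup := fun u => by
    rw [hL]
    refine (hnd u).map_on fun x hx y hy hxy => ?_
    exact SimpleGraph.Dart.ext _ _
      (Prod.ext ((hmem u x hx).1.trans (hmem u y hy).1.symm) hxy)
  have hpeak : ∀ u, ∃ p, G.succList u ≠ [] → p < (G.succList u).length ∧
      (∀ i, ∀ hi : i + 1 < (G.succList u).length, i < p →
        ¬ G.HasPath (G.succList u)[i + 1] (G.succList u)[i]) ∧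
      (∀ i, ∀ hi : i + 1 < (G.succList u).length, p ≤ i →
        ¬ G.HasPath (G.succList u)[i] (G.succList u)[i + 1]) := by
    intro u
    by_cases hne : G.succList u = []
    · exact ⟨0, fun h => (h hne).elim⟩
    · obtain ⟨p, hp⟩ := exists_peak (h u) (hnds u) hne
      exact ⟨p, fun _ => hp⟩
  choose p hp using hpeak
  -- `P` marks the corners before the peak and `Q` those from the peak on. The bound on `i + 1`
  -- excludes the last dart of a list, after which no edge is added.
  let P : G.Dart → Prop := fun k => ∃ u i, ∃ hi : i + 1 < (L u).length, k = (L u)[i] ∧ i < p u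
  let Q : G.Dart → Prop := fun k => ∃ u i, ∃ hi : i + 1 < (L u).length, k = (L u)[i] ∧ p u ≤ i
  have hPQ : ∀ k, P k ∨ Q k → ∃ u i, ∃ hi : i + 1 < (L u).length, k = (L u)[i] := by
    rintro k (⟨u, i, hi, hk, -⟩ | ⟨u, i, hi, hk, -⟩) <;> exact ⟨u, i, hi, hk⟩
  have hadm : IsAdmissible P Q := by
    refine ⟨fun k hk => ?_, fun k hk => ?_, ?_, ?_, ?_⟩
    · obtain ⟨u, i, hi, rfl⟩ := hPQ k hk
      exact ⟨(hmem u _ (List.getElem_mem _)).2,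
        (hnext u i hi).1 ▸ (hmem u _ (List.getElem_mem _)).2⟩
    · obtain ⟨u, i, hi, rfl⟩ := hPQ k hk
      rw [(hnext u i hi).1]
      exact (hnext u i hi).2
    · rintro k ⟨u, i, hi, rfl, hip⟩
      have hi' : i + 1 < (G.succList u).length := hlen u ▸ hi
      have := (hp u (List.ne_nil_of_length_pos (by omega))).2.1 i hi' hip
      rwa [hget, hget, ← (hnext u i hi).1] at this
    · rintro k ⟨u, i, hi, rfl, hip⟩
      have hi' : i + 1 < (G.succList u).length := hlen u ▸ hi
      have := (hp u (List.ne_nil_of_length_pos (by omega))).2.2 i hi' hip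
      rwa [hget, hget, ← (hnext u i hi).1] at this
    · rintro k ⟨u, i, hi, rfl, hip⟩ ⟨u', i', hi', heq, hip'⟩
      have huu : u = u' := by
        rw [← (hmem u _ (List.getElem_mem (by omega : i < _))).1, heq]
        exact (hmem u' _ (List.getElem_mem _)).1
      subst huu
      have := (hnd u).getElem_inj_iff.1 heq
      omega
  refine ⟨AugAdj P Q, hadm.not_transGen_augAdj, fun _ _ => Or.inl, fun u => ?_⟩
  by_cases hne : G.succList u = []
  · exact Or.inl hne
  refine Or.inr ⟨p u, (hp u hne).1, fun i hi hip => ?_, fun i hi hip => ?_⟩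
  · have hi' : i + 1 < (L u).length := hlen u ▸ hi
    refine Or.inr (Or.inl ⟨_, ⟨u, i, hi', rfl, hip⟩, hget _ _ _, ?_⟩)
    rw [hget, (hnext u i hi').1]
  · have hi' : i + 1 < (L u).length := hlen u ▸ hi
    refine Or.inr (Or.inr ⟨_, ⟨u, i, hi', rfl, hip⟩, ?_, hget _ _ _⟩)
    rw [hget, (hnext u i hi').1]

theorem le_of_hasPath {π : V → ℕ} (hπ : ∀ u v, G.graph.Adj u v → π u < π v)
    {u v : V} (h : G.HasPath u v) : π u ≤ π v := by
  induction h with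
  | refl => rfl
  | tail _ hvw ih => exact ih.trans (hπ _ _ hvw).le

theorem isSTOrdering_of_bijOn [Finite V] {π : V → ℕ}
    (hbij : Set.BijOn π Set.univ (Set.Icc 1 (Nat.card V)))
    (hπ : ∀ u v, G.graph.Adj u v → π u < π v) : G.IsSTOrdering π := by
  have : Nonempty V := ⟨G.s⟩
  refine ⟨hbij, ?_, ?_, hπ⟩
  · obtain ⟨v, -, hv⟩ := hbij.surjOn (Set.left_mem_Icc.2 Nat.card_pos)
    have h1 := le_of_hasPath hπ (hasPath_source v)
    have h2 := (hbij.mapsTo (Set.mem_univ G.s)).1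
    omega
  · obtain ⟨v, -, hv⟩ := hbij.surjOn (Set.right_mem_Icc.2 Nat.card_pos)
    have h1 := le_of_hasPath hπ (hasPath_sink v)
    have h2 := (hbij.mapsTo (Set.mem_univ G.t)).2
    omega

theorem IsBitonicSTOrdering.not_hasForbiddenConfiguration {π : V → ℕ}
    (hπ : G.IsBitonicSTOrdering π) (u : V) : ¬ G.HasForbiddenConfiguration u := by
  rintro ⟨i, j, hij, hj, h1, h2⟩
  have h1' := le_of_hasPath hπ.1.2.2.2 h1
  have h2' := le_of_hasPath hπ.1.2.2.2 h2
  rcases hπ.2 u with h | ⟨p, -, hinc, hdec⟩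
  · simp [h] at hj
  -- Before the peak the ascent at `i` contradicts the first path; otherwise `j > i` is past the
  -- peak and the descent at `j` contradicts the second.
  · rcases lt_or_ge i p with hip | hip
    · exact (hinc i (by omega) hip).not_ge h1'
    · exact (hdec j hj (by omega)).not_ge h2'

end EmbeddedPlanarSTGraph

theorem mainTheorem4 {V : Type*} [Finite V] (G : EmbeddedPlanarSTGraph V) :
    (∃ π : V → ℕ, G.IsBitonicSTOrdering π) ↔ ∀ u : V, ¬ G.HasForbiddenConfiguration u := by
  refine ⟨fun ⟨π, hπ⟩ => hπ.not_hasForbiddenConfiguration, fun h => ?_⟩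
  obtain ⟨r, hr, hadj, hlist⟩ := EmbeddedPlanarSTGraph.exists_augAdj h
  obtain ⟨π, hbij, hπ⟩ := exists_topological_numbering r hr
  refine ⟨π, EmbeddedPlanarSTGraph.isSTOrdering_of_bijOn hbij fun u v huv =>
    hπ u v (hadj u v huv), fun u => ?_⟩
  exact (hlist u).imp_right fun ⟨p, hp, hinc, hdec⟩ =>
    ⟨p, hp, fun i hi hip => hπ _ _ (hinc i hi hip), fun i hi hip => hπ _ _ (hdec i hi hip)⟩
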